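/- A box in a two-party Bell scenario is a table $P(a,b|x,y)$ of conditional probabilities of outputs $a,b$ given inputs $x,y$. It is classical if it is a convex mixture of local deterministic boxes $\delta_{a,f(x)}\,\delta_{b,g(y)}$. A Hardy frame consists of a set $S_0$ of combinations $(a,b,x,y)$, a pair of inputs $(x^*,y^*)$ and a set $H$ of output pairs such that some classical box satisfies $P(a,b|x,y)=0$ for all $(a,b,x,y)\in S_0$, and every classical box that does so has $p_H:=\sum_{(a,b)\in H}P(a,b|x^*,y^*)=0$. A Hardy paradox for a state $\psi\in\mathbb{C}^d\otimes\mathbb{C}^d$ consists of a Hardy frame with finitely many inputs and with $d$ outputs for each party, and of orthonormal bases $(u_{x,a})_{a=1}^{d}$ and $(v_{y,b})_{b=1}^{d}$ of $\mathbb{C}^d$ for each input $x$ and $y$, such that the quantum box $P(a,b|x,y)=|\langle u_{x,a}\otimes v_{y,b}|\psi\rangle|^2$ vanishes on $S_0$ and has $p_H>0$; the number $p_H$ is its nonzero (Hardy) probability. Let $\psi_d=\frac{1}{\sqrt d}\sum_{i=0}^{d-1}|i,i\rangle$ be the maximally entangled state. (1) For every $d\ge 3$ and every $p\in(0,\frac1d]$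 there is a Hardy paradox for $\psi_d$ with a single Hardy output pair, $H=\{(a^*,b^*)\}$, and Hardy probability $p_H=P(a^*,b^*|x^*,y^*)=p$. (2) For $d=4$ and for $d=8$, and for every $p\in(0,1]$, there is a Hardy paradox for $\psi_d$ with the $d$ Hardy output pairs $H=\{(k,k):1\le k\le d\}$ and Hardy probability $p_H=\sum_{k=1}^{d}P(k,k|x^*,y^*)=p$. -/

import Mathlib

open scoped TensorProduct

noncomputable section

namespace HardyParadox

/-- A table `P a b x y` of conditional probabilities `P(a,b|x,y)` in a two-party Bell scenario
with inputs `x : X`, `y : Y` and outputs `a : A`, `b : B`. -/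
abbrev Box (A B X Y : Type*) := A → B → X → Y → ℝ

open Classical in
/-- The local deterministic box in which the parties answer by the functions `f` and `g`. -/
def detBox {A B X Y : Type*} (f : X → A) (g : Y → B) : Box A B X Y :=
  fun a b x y => if f x = a ∧ g y = b then 1 else 0

/-- A classical (local) box: a finite convex mixture of local deterministic boxes. -/
def IsClassical {A B X Y : Type*} (P : Box A B X Y) : Prop :=
  P ∈ convexHull ℝ {Q : Box A B X Y | ∃ (f : X → A) (g : Y → B), Q = detBox f g}

/-- The box has a zero at every input-output combination in `S`. -/
def Satisfies {A B X Y : Type*} (P : Box A B X Y) (S : Set (A × B × X × Y)) : Prop :=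
  ∀ a b x y, (a, b, x, y) ∈ S → P a b x y = 0

/-- The probability, for the inputs `x` and `y`, that the pair of outputs lies in `H`. -/
def hardyProb {A B X Y : Type*} (P : Box A B X Y) (H : Finset (A × B)) (x : X) (y : Y) : ℝ :=
  ∑ ab ∈ H, P ab.1 ab.2 x y

/-- A Hardy frame: the zeros `S` can be satisfied by a classical box, and every classical box
that satisfies them gives probability zero to the output set `H` for the inputs `x`, `y`. -/
structure IsHardyFrame {A B X Y : Type*} (S : Set (A × B × X × Y)) (H : Finset (A × B))
    (x : X) (y : Y) : Prop where
  exists_classical : ∃ P : Box A B X Y, IsClassical P ∧ Satisfies P S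
  classical_zero : ∀ P : Box A B X Y, IsClassical P → Satisfies P S → hardyProb P H x y = 0

/-- The box `P` exhibits a Hardy paradox: it has the zeros of a Hardy frame, and yet the Hardy
outputs have nonzero probability. -/
structure IsHardyParadox {A B X Y : Type*} (S : Set (A × B × X × Y)) (H : Finset (A × B))
    (x : X) (y : Y) (P : Box A B X Y) : Prop where
  frame : IsHardyFrame S H x y
  zeros : Satisfies P S
  pos : 0 < hardyProb P H x y

/-- The one-party state space `ℂ^d`. -/
abbrev Qudit (d : ℕ) := EuclideanSpace ℂ (Fin d)

/-- The maximally entangled state `(1/√d) ∑ i, |i⟩ ⊗ |i⟩` of `ℂ^d ⊗ ℂ^d`. -/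
def maxEntangled (d : ℕ) : Qudit d ⊗[ℂ] Qudit d :=
  ((1 / Real.sqrt d : ℝ) : ℂ) •
    ∑ i : Fin d, (EuclideanSpace.single i (1 : ℂ) ⊗ₜ[ℂ] EuclideanSpace.single i (1 : ℂ))

/-- The quantum box obtained when the parties share the state `ψ` and, on inputs `x` and `y`,
measure in the orthonormal bases `α x` and `β y`: by the Born rule
`P(a,b|x,y) = |⟨α_{x,a} ⊗ β_{y,b} | ψ⟩|²`. -/
def quantumBox {d : ℕ} {X Y : Type*} (ψ : Qudit d ⊗[ℂ] Qudit d)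
    (α : X → OrthonormalBasis (Fin d) ℂ (Qudit d))
    (β : Y → OrthonormalBasis (Fin d) ℂ (Qudit d)) : Box (Fin d) (Fin d) X Y :=
  fun a b x y => ‖inner ℂ (α x a ⊗ₜ[ℂ] β y b) ψ‖ ^ 2

/-- The `d` output pairs `(k,k)`. -/
def diagonalOutputs (d : ℕ) : Finset (Fin d × Fin d) :=
  Finset.univ.image fun k => (k, k)

end HardyParadox

end

/-!
Alice's vector `u` and Bob's vector `v` have joint probability `|⟨u, v̄⟩|² / d` in the maximally
entangled state, so with Bob measuring in conjugate bases the zeros of the quantum box are exactly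
the orthogonal pairs (`quantumBox_maxEntangled`). Deterministic strategies that avoid every zero
would select the same vector from a basis on both sides and would never select two orthogonal
vectors; the Kochen–Specker theorem (`kochen_specker`) excludes this in dimension `d ≥ 3`. It is
proved for all bases at once: after completing a selected vector to a basis, one looks only at
integer combinations of three basis vectors, where the propagation of values from `(1,0,0)` and
`(1,1,0)` is contradictory.

By compactness finitely many zeros are already contradictory. Adding them one at a time, there is a
last satisfiable set `S` and a zero, orthogonal vectors `w` for Alice and `w'` for Bob, that
destroys satisfiability; every strategy compatible with `S` must then answer `w` and `w'` at the
two inputs concerned (`exists_forced_orthogonal`). These forced answers can be transported, through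
fresh inputs, to arbitrary bases `U ∋ w` and `V ∋ w'` (`exists_forced_outputs`). Hence every set
`H` of output pairs that does not contain the forced one gives a Hardy paradox, whose probability
depends only on the overlaps of `U` and `V`.

Those overlaps are then adjusted. For a single pair, one vector of `V` is rotated towards the
relevant vector of `U` (`exists_bases_single_overlap`). For the diagonal pairs, `w` and `w'` are put
at different positions and the coordinate planes `{k, τ k}` of a fixed-point-free involution `τ`
are all rotated by the same angle, which gives all diagonal overlaps the common value `p`
(`exists_bases_diagonal_overlap`); this uses that `d` is even and at least four.
-/

namespace HardyParadox

open scoped ComplexConjugate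

/-- The pair of local deterministic strategies `f`, `g` avoids all the combinations in `S`. -/
def Avoids {A B X Y : Type*} (S : Set (A × B × X × Y)) (f : X → A) (g : Y → B) : Prop :=
  ∀ a b x y, (a, b, x, y) ∈ S → ¬(f x = a ∧ g y = b)

/-- Orthonormal bases of `ℂ^d`, labelled by `Fin d`. -/
abbrev ONB (d : ℕ) := OrthonormalBasis (Fin d) ℂ (Qudit d)

/-! ### Frames and deterministic strategies -/

lemma hardyProb_detBox {A B X Y : Type*} (H : Finset (A × B)) (f : X → A) (g : Y → B)
    (x : X) (y : Y) [Decidable ((f x, g y) ∈ H)] :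
    hardyProb (detBox f g) H x y = if (f x, g y) ∈ H then 1 else 0 := by
  classical
  have h : ∀ ab : A × B, detBox f g ab.1 ab.2 x y = if ab = (f x, g y) then 1 else 0 := by
    rintro ⟨a, b⟩
    simp [detBox, eq_comm]
  simp only [hardyProb, h, Finset.sum_ite_eq']
  congr

/-- By convexity the frame conditions need only be checked on deterministic strategies: the
Hardy probability of a classical box is at most the sum of its entries on `S`. -/
lemma isHardyFrame_of_avoids {A B X Y : Type*} {S : Set (A × B × X × Y)} (hS : S.Finite)
    {H : Finset (A × B)} {x : X} {y : Y} (hsat : ∃ f g, Avoids S f g)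
    (hH : ∀ f g, Avoids S f g → (f x, g y) ∉ H) : IsHardyFrame S H x y := by
  classical
  refine ⟨?_, ?_⟩
  · obtain ⟨f, g, hfg⟩ := hsat
    exact ⟨detBox f g, subset_convexHull ℝ _ ⟨f, g, rfl⟩,
      fun a b x y h => if_neg (hfg a b x y h)⟩
  · intro P hP hPS
    let total : Box A B X Y → ℝ := fun Q => ∑ s ∈ hS.toFinset, Q s.1 s.2.1 s.2.2.1 s.2.2.2
    have hsub : convexHull ℝ {Q : Box A B X Y | ∃ (f : X → A) (g : Y → B), Q = detBox f g} ⊆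
        {Q | 0 ≤ hardyProb Q H x y ∧ hardyProb Q H x y ≤ total Q} := by
      refine convexHull_min ?_ ?_
      · rintro _ ⟨f, g, rfl⟩
        have hnn : ∀ s ∈ hS.toFinset, 0 ≤ detBox f g s.1 s.2.1 s.2.2.1 s.2.2.2 := by
          intro s _
          unfold detBox
          split_ifs <;> norm_num
        rw [Set.mem_ofPred_eq, hardyProb_detBox]
        split_ifs with h
        · have hv : ¬ Avoids S f g := fun hv => hH f g hv h
          simp only [Avoids, not_forall, not_not] at hv
          obtain ⟨a, b, x', y', hs, hab⟩ := hv
          refine ⟨zero_le_one, ?_⟩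
          calc (1 : ℝ) = detBox f g a b x' y' := (if_pos hab).symm
            _ ≤ total (detBox f g) := Finset.single_le_sum hnn (hS.mem_toFinset.2 hs)
        · exact ⟨le_rfl, Finset.sum_nonneg hnn⟩
      · intro P hP Q hQ s t hs ht _
        have h1 : hardyProb (s • P + t • Q) H x y =
            s * hardyProb P H x y + t * hardyProb Q H x y := by
          simp [hardyProb, Finset.sum_add_distrib, Finset.mul_sum]
        have h2 : total (s • P + t • Q) = s * total P + t * total Q := by
          simp [total, Finset.sum_add_distrib, Finset.mul_sum]
        rw [Set.mem_ofPred_eq, h1, h2]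
        obtain ⟨hP0, hP1⟩ := hP
        obtain ⟨hQ0, hQ1⟩ := hQ
        exact ⟨by positivity, by gcongr⟩
    obtain ⟨h0, h1⟩ := hsub hP
    have h2 : total P = 0 := Finset.sum_eq_zero fun s hs =>
      hPS _ _ _ _ (hS.mem_toFinset.1 hs)
    linarith

/-! ### Orthonormal bases and the quantum box -/

lemma exists_basis_extending {d : ℕ} {ι : Type*} [Fintype ι] [DecidableEq ι]
    (hι : Fintype.card ι = d) (v : ι → Qudit d) (s : Set ι)
    (hv : ∀ i ∈ s, ∀ j ∈ s, inner ℂ (v i) (v j) = if i = j then (1 : ℂ) else 0) :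
    ∃ b : OrthonormalBasis ι ℂ (Qudit d), ∀ i ∈ s, b i = v i := by
  refine Orthonormal.exists_orthonormalBasis_extension_of_card_eq (by simp [hι]) ?_
  rw [orthonormal_iff_ite]
  rintro ⟨i, hi⟩ ⟨j, hj⟩
  simpa using hv i hi j hj

lemma exists_conj_basis {d : ℕ} (b : ONB d) :
    ∃ b' : ONB d, ∀ k i, b' k i = conj (b k i) := by
  obtain ⟨b', hb'⟩ := exists_basis_extending (Fintype.card_fin d)
    (fun k => (WithLp.toLp 2 fun i => conj (b k i) : Qudit d)) Set.univ (by
      intro i _ j _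
      have h := congrArg conj (orthonormal_iff_ite.1 b.orthonormal i j)
      rw [apply_ite conj, map_one, map_zero] at h
      rw [← h]
      simp [PiLp.inner_apply])
  exact ⟨b', fun k i => by rw [hb' k trivial]⟩

/-- The maximally entangled state pairs a vector with its complex conjugate, so that the box is
governed by the overlaps of Alice's vectors with the conjugates of Bob's. -/
lemma quantumBox_maxEntangled {d : ℕ} {X Y : Type*} (α : X → ONB d) (β β' : Y → ONB d)
    (hβ : ∀ y k i, β' y k i = conj (β y k i)) (a b : Fin d) (x : X) (y : Y) :
    quantumBox (maxEntangled d) α β' a b x y = ‖inner ℂ (α x a) (β y b)‖ ^ 2 / d := by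
  have h : inner ℂ (α x a ⊗ₜ[ℂ] β' y b) (maxEntangled d) =
      ((1 / Real.sqrt d : ℝ) : ℂ) * inner ℂ (α x a) (β y b) := by
    refine (inner_smul_right (𝕜 := ℂ) (α x a ⊗ₜ[ℂ] β' y b)
      (∑ i, EuclideanSpace.single i 1 ⊗ₜ[ℂ] EuclideanSpace.single i 1) _).trans ?_
    rw [PiLp.inner_apply]
    congr 1
    refine (inner_sum _ _ _).trans ?_
    refine Finset.sum_congr rfl fun i _ => ?_
    simp [TensorProduct.inner_tmul, EuclideanSpace.inner_single_right, hβ, mul_comm]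
  rw [quantumBox, h, norm_mul, mul_pow, Complex.norm_real, Real.norm_eq_abs, sq_abs, div_pow,
    Real.sq_sqrt (Nat.cast_nonneg d)]
  ring

/-- A finite set of orthogonality constraints that deterministic strategies can avoid, but only
with outputs outside `H`, yields a Hardy paradox with finitely many inputs: keep the inputs that
occur in the constraints, and let Bob measure in the conjugate bases. -/
lemma exists_isHardyParadox {d : ℕ} {X Y : Type*} (α : X → ONB d) (β : Y → ONB d)
    {S : Set (Fin d × Fin d × X × Y)} (hS : S.Finite)
    (hzero : ∀ a b x y, (a, b, x, y) ∈ S → inner ℂ (α x a) (β y b) = 0)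
    {H : Finset (Fin d × Fin d)} {x : X} {y : Y} (hsat : ∃ f g, Avoids S f g)
    (hH : ∀ f g, Avoids S f g → (f x, g y) ∉ H) {p : ℝ} (hp : 0 < p)
    (hprob : ∑ ab ∈ H, ‖inner ℂ (α x ab.1) (β y ab.2)‖ ^ 2 / d = p) :
    ∃ (m n : ℕ) (α' : Fin m → ONB d) (β' : Fin n → ONB d) (S' : Set (Fin d × Fin d × Fin m × Fin n))
      (x' : Fin m) (y' : Fin n),
      IsHardyParadox S' H x' y' (quantumBox (maxEntangled d) α' β') ∧
      hardyProb (quantumBox (maxEntangled d) α' β') H x' y' = p := by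
  classical
  let XA : Finset X := insert x (hS.toFinset.image fun s => s.2.2.1)
  let YB : Finset Y := insert y (hS.toFinset.image fun s => s.2.2.2)
  let i : Fin XA.card → X := fun k => XA.equivFin.symm k
  let j : Fin YB.card → Y := fun k => YB.equivFin.symm k
  have hi : i.Injective := Subtype.val_injective.comp XA.equivFin.symm.injective
  have hj : j.Injective := Subtype.val_injective.comp YB.equivFin.symm.injective
  have hiX : ∀ u ∈ XA, ∃ k, i k = u := fun u hu => ⟨XA.equivFin ⟨u, hu⟩, by simp [i]⟩
  have hjY : ∀ v ∈ YB, ∃ k, j k = v := fun v hv => ⟨YB.equivFin ⟨v, hv⟩, by simp [j]⟩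
  have hSX : ∀ a b u v, (a, b, u, v) ∈ S → u ∈ XA := fun a b u v h =>
    Finset.mem_insert_of_mem (Finset.mem_image.2 ⟨_, hS.mem_toFinset.2 h, rfl⟩)
  have hSY : ∀ a b u v, (a, b, u, v) ∈ S → v ∈ YB := fun a b u v h =>
    Finset.mem_insert_of_mem (Finset.mem_image.2 ⟨_, hS.mem_toFinset.2 h, rfl⟩)
  obtain ⟨x', hx'⟩ := hiX x (Finset.mem_insert_self _ _)
  obtain ⟨y', hy'⟩ := hjY y (Finset.mem_insert_self _ _)
  choose β' hβ' using fun k => exists_conj_basis (β (j k))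
  obtain ⟨f₀, g₀, h₀⟩ := hsat
  let S' : Set (Fin d × Fin d × Fin XA.card × Fin YB.card) :=
    {s | (s.1, s.2.1, i s.2.2.1, j s.2.2.2) ∈ S}
  have hbox := quantumBox_maxEntangled (fun k => α (i k)) (fun k => β (j k)) β' hβ'
  have hp' : hardyProb (quantumBox (maxEntangled d) (fun k => α (i k)) β') H x' y' = p := by
    rw [← hprob, hardyProb]
    refine Finset.sum_congr rfl fun ab _ => ?_
    rw [hbox, hx', hy']
  refine ⟨_, _, fun k => α (i k), β', S', x', y', ⟨?_, ?_, hp'.symm ▸ hp⟩, hp'⟩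
  · refine isHardyFrame_of_avoids (Set.toFinite _)
      ⟨f₀ ∘ i, g₀ ∘ j, fun a b u v h => h₀ a b (i u) (j v) h⟩ fun f g hfg => ?_
    have hext : Avoids S (Function.extend i f f₀) (Function.extend j g g₀) := by
      intro a b u v h
      obtain ⟨k, rfl⟩ := hiX u (hSX a b u v h)
      obtain ⟨l, rfl⟩ := hjY v (hSY a b _ v h)
      rw [hi.extend_apply, hj.extend_apply]
      exact hfg a b k l h
    have := hH _ _ hext
    rwa [← hx', ← hy', hi.extend_apply, hj.extend_apply] at this
  · intro a b u v h
    rw [hbox, hzero a b _ _ h]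
    simp

/-! ### The Kochen–Specker theorem -/

/-- The integer vectors `(1,0,0)` and `(1,1,0)`, at angle `45°`, cannot both be coloured, if
orthogonal vectors are never both coloured and every orthogonal triple contains a coloured vector.
-/
lemma not_colored_of_colored {T : ℤ → ℤ → ℤ → Prop}
    (hF : ∀ {a b c : ℤ} (a' b' c' : ℤ), T a b c → a * a' + b * b' + c * c' = 0 → ¬ T a' b' c')
    (hT : ∀ {a b c a' b' c' : ℤ} (a'' b'' c'' : ℤ), ¬ T a b c → ¬ T a' b' c' →
      (a, b, c) ≠ 0 → (a', b', c') ≠ 0 → (a'', b'', c'') ≠ 0 →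
      a * a' + b * b' + c * c' = 0 → a * a'' + b * b'' + c * c'' = 0 →
      a' * a'' + b' * b'' + c' * c'' = 0 → T a'' b'' c'')
    (h100 : T 1 0 0) : ¬ T 1 1 0 := by
  intro h110
  have h010 := hF 0 1 0 h100 (by decide)
  have hm110 := hF 1 (-1) 0 h110 (by decide)
  have h211 := hT 2 1 1 (hF 0 1 (-1) h100 (by decide)) (hF 1 (-1) (-1) h110 (by decide))
    (by decide) (by decide) (by decide) (by decide) (by decide) (by decide)
  have h21m := hT 2 1 (-1) (hF 0 1 1 h100 (by decide)) (hF 1 (-1) 1 h110 (by decide))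
    (by decide) (by decide) (by decide) (by decide) (by decide) (by decide)
  have h20m := hT 2 0 (-1) h010 (hF 1 0 2 h21m (by decide))
    (by decide) (by decide) (by decide) (by decide) (by decide) (by decide)
  have h201 := hT 2 0 1 h010 (hF 1 0 (-2) h211 (by decide))
    (by decide) (by decide) (by decide) (by decide) (by decide) (by decide)
  have h111 := hT 1 1 1 hm110 (hF 1 1 (-2) h201 (by decide))
    (by decide) (by decide) (by decide) (by decide) (by decide) (by decide)
  have h11m := hT 1 1 (-1) hm110 (hF 1 1 2 h20m (by decide))
    (by decide) (by decide) (by decide) (by decide) (by decide) (by decide)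
  exact hF 1 0 (-1) h111 (by decide) <| hT 1 0 (-1) h010 (hF 1 0 1 h11m (by decide))
    (by decide) (by decide) (by decide) (by decide) (by decide) (by decide)

lemma not_colored_unit {T : ℤ → ℤ → ℤ → Prop}
    (hF : ∀ {a b c : ℤ} (a' b' c' : ℤ), T a b c → a * a' + b * b' + c * c' = 0 → ¬ T a' b' c')
    (hT : ∀ {a b c a' b' c' : ℤ} (a'' b'' c'' : ℤ), ¬ T a b c → ¬ T a' b' c' →
      (a, b, c) ≠ 0 → (a', b', c') ≠ 0 → (a'', b'', c'') ≠ 0 →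
      a * a' + b * b' + c * c' = 0 → a * a'' + b * b'' + c * c'' = 0 →
      a' * a'' + b' * b'' + c' * c'' = 0 → T a'' b'' c'') : ¬ T 1 0 0 := by
  intro h100
  have h110 := not_colored_of_colored hF hT h100
  have hm110 : ¬ T 1 (-1) 0 := by
    -- the reflection `y ↦ -y` preserves both rules
    refine not_colored_of_colored (T := fun a b c => T a (-b) c)
      (fun a' b' c' h h0 => hF _ _ _ h (by linarith))
      (fun {a b c a' b' c'} a'' b'' c'' h h' n n' n'' h1 h2 h3 =>
        hT _ _ _ h h' ?_ ?_ ?_ (by linarith) (by linarith) (by linarith)) (by simpa using h100)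
    · simpa using n
    · simpa using n'
    · simpa using n''
  exact hF 0 0 1 h100 (by decide) <| hT 0 0 1 h110 hm110
    (by decide) (by decide) (by decide) (by decide) (by decide) (by decide)

/-- The Kochen–Specker theorem in dimension `d ≥ 3`: one cannot select a vector from every
orthonormal basis so that no two selected vectors are orthogonal. -/
theorem kochen_specker {d : ℕ} (hd : 3 ≤ d) (f : ONB d → Fin d) :
    ∃ U V : ONB d, inner ℂ (U (f U)) (V (f V)) = 0 := by
  by_contra! hf
  obtain ⟨n, rfl⟩ := Nat.exists_eq_add_of_le hd
  let σ : Fin 3 ⊕ Fin n ≃ Fin (3 + n) := finSumFinEquiv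
  let U₀ : ONB (3 + n) := EuclideanSpace.basisFun _ ℂ
  set w := U₀ (f U₀) with hw
  -- a basis that starts with a selected vector `w`
  obtain ⟨e, he⟩ := exists_basis_extending (d := 3 + n) (ι := Fin 3 ⊕ Fin n) (by simp)
    (fun _ => w) {Sum.inl 0} (by
      rintro i rfl j rfl
      simp [hw])
  have hew : e (Sum.inl 0) = w := he _ rfl
  have hee := orthonormal_iff_ite.1 e.orthonormal
  let L : ℤ → ℤ → ℤ → Qudit (3 + n) := fun a b c =>
    (a : ℂ) • e (Sum.inl 0) + (b : ℂ) • e (Sum.inl 1) + (c : ℂ) • e (Sum.inl 2)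
  have hLL : ∀ a b c a' b' c' : ℤ,
      inner ℂ (L a b c) (L a' b' c') = ((a * a' + b * b' + c * c' : ℤ) : ℂ) := by
    intro a b c a' b' c'
    simp [L, hee]
    ring
  have hLe : ∀ (a b c : ℤ) (k : Fin n), inner ℂ (L a b c) (e (Sum.inr k)) = 0 := by
    intro a b c k
    simp [L, hee]
  have hL0 : ∀ a b c : ℤ, (a, b, c) ≠ 0 → L a b c ≠ 0 := by
    intro a b c h h0
    have h1 := hLL a b c a b c
    rw [h0, inner_zero_left, eq_comm, Int.cast_eq_zero] at h1
    apply h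
    have ha : a = 0 := by nlinarith [mul_self_nonneg a, mul_self_nonneg b, mul_self_nonneg c]
    have hb : b = 0 := by nlinarith [mul_self_nonneg a, mul_self_nonneg b, mul_self_nonneg c]
    have hc : c = 0 := by nlinarith [mul_self_nonneg a, mul_self_nonneg b, mul_self_nonneg c]
    simp [ha, hb, hc]
  refine not_colored_unit (T := fun a b c => ∃ (U : ONB (3 + n)) (r : ℂ), U (f U) = r • L a b c)
    ?_ ?_ ⟨U₀, 1, by simp [L, hew, hw]⟩
  · rintro a b c a' b' c' ⟨U, r, hU⟩ h0 ⟨V, s, hV⟩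
    apply hf U V
    rw [hU, hV, inner_smul_left, inner_smul_right, hLL, h0]
    simp
  · intro a b c a' b' c' a'' b'' c'' h h' n0 n0' n0'' h1 h2 h3
    let t : Fin 3 → Qudit (3 + n) := ![L a b c, L a' b' c', L a'' b'' c'']
    have ht0 : ∀ i, t i ≠ 0 := by
      intro i
      fin_cases i
      exacts [hL0 _ _ _ n0, hL0 _ _ _ n0', hL0 _ _ _ n0'']
    have htt : ∀ i j, i ≠ j → inner ℂ (t i) (t j) = 0 := by
      intro i j hij
      fin_cases i <;> fin_cases j <;>
        first
        | exact absurd rfl hij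
        | exact (hLL _ _ _ _ _ _).trans (Int.cast_eq_zero.2 (by linarith))
    have hte : ∀ i k, inner ℂ (t i) (e (Sum.inr k)) = 0 := by
      intro i k
      fin_cases i <;> exact hLe _ _ _ _
    -- the normalised triple, completed by the vectors of `e` outside the three-dimensional block
    obtain ⟨u, hu⟩ := exists_basis_extending (d := 3 + n) (ι := Fin 3 ⊕ Fin n) (by simp)
      (Sum.elim (fun i => (‖t i‖ : ℂ)⁻¹ • t i) (fun k => e (Sum.inr k))) Set.univ (by
        rintro (i | i) - (j | j) -
        · rcases eq_or_ne i j with rfl | hij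
          · have : ‖(‖t i‖ : ℂ)⁻¹ • t i‖ = 1 := norm_smul_inv_norm (ht0 i)
            simp [inner_self_eq_norm_sq_to_K, this]
          · simp [htt i j hij, hij]
        · simp [hte]
        · have := inner_eq_zero_symm.1 (hte j i)
          simp [this]
        · simp [hee])
    have hsel : (u.reindex σ) (f (u.reindex σ)) = u (σ.symm (f (u.reindex σ))) := by simp
    rcases hk : σ.symm (f (u.reindex σ)) with i | k
    · rw [hk, hu _ trivial] at hsel
      fin_cases i
      · exact absurd ⟨_, _, hsel⟩ h
      · exact absurd ⟨_, _, hsel⟩ h'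
      · exact ⟨_, _, hsel⟩
    · rw [hk, hu _ trivial] at hsel
      refine absurd ?_ (hf (u.reindex σ) U₀)
      rw [hsel, ← hw, ← hew, Sum.elim_inr, hee]
      simp

/-! ### Strategies with forced outputs -/

/-- By compactness, the Kochen–Specker theorem yields a finite set of orthogonality constraints
that can be avoided, but not together with one further such constraint. The strategies avoiding
the former therefore produce exactly the outputs excluded by the latter. -/
lemma exists_forced_orthogonal {d : ℕ} (hd : 3 ≤ d) :
    ∃ (S : Set (Fin d × Fin d × ONB d × ONB d)) (a b : Fin d) (U V : ONB d), S.Finite ∧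
      (∀ a b U V, (a, b, U, V) ∈ S → inner ℂ (U a) (V b) = 0) ∧ inner ℂ (U a) (V b) = 0 ∧
      (∃ f g, Avoids S f g) ∧ ∀ f g, Avoids S f g → f U = a ∧ g V = b := by
  classical
  by_contra! hcon
  let Z := {s : Fin d × Fin d × ONB d × ONB d // inner ℂ (s.2.2.1 s.1) (s.2.2.2 s.2.1) = 0}
  have hfin : ∀ F : Finset Z, ∃ f g, Avoids (Subtype.val '' (F : Set Z)) f g := by
    intro F
    induction F using Finset.induction_on with
    | empty => exact ⟨fun _ => ⟨0, by omega⟩, fun _ => ⟨0, by omega⟩, by simp [Avoids]⟩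
    | insert z F _ ih =>
      obtain ⟨⟨a, b, U, V⟩, hz⟩ := z
      obtain ⟨f, g, hfg, hne⟩ := hcon (Subtype.val '' (F : Set Z)) a b U V
        (F.finite_toSet.image _) (by rintro a b U V ⟨s, -, hs⟩; simpa [hs] using s.2) hz ih
      refine ⟨f, g, ?_⟩
      rintro a' b' U' V' ⟨s, hs, hs'⟩
      rcases Finset.mem_insert.1 (Finset.mem_coe.1 hs) with rfl | hs
      · obtain ⟨rfl, rfl, rfl, rfl⟩ := by simpa using hs'
        exact fun h => hne h.1 h.2
      · exact hfg a' b' U' V' ⟨s, hs, hs'⟩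
  let C : Z → Set ((ONB d → Fin d) × (ONB d → Fin d)) := fun z =>
    {q | ¬ (q.1 z.1.2.2.1 = z.1.1 ∧ q.2 z.1.2.2.2 = z.1.2.1)}
  have hC : ∀ z, IsClosed (C z) := fun z =>
    (isClosed_discrete {r : Fin d × Fin d | ¬ (r.1 = z.1.1 ∧ r.2 = z.1.2.1)}).preimage
      (f := fun q : (ONB d → Fin d) × (ONB d → Fin d) => (q.1 z.1.2.2.1, q.2 z.1.2.2.2))
      (by fun_prop)
  obtain ⟨⟨f, g⟩, hfg⟩ := CompactSpace.iInter_nonempty hC fun F => by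
    obtain ⟨f, g, hfg⟩ := hfin F
    exact ⟨(f, g), Set.mem_iInter₂.2 fun z hz => hfg _ _ _ _ ⟨z, hz, rfl⟩⟩
  have hfg' : ∀ U V : ONB d, inner ℂ (U (f U)) (V (g V)) ≠ 0 := fun U V h =>
    Set.mem_iInter.1 hfg ⟨(f U, g V, U, V), h⟩ ⟨rfl, rfl⟩
  have hfeq : ∀ U, f U = g U := by
    intro U
    by_contra hne
    exact hfg' U U (by simp [orthonormal_iff_ite.1 U.orthonormal, hne])
  obtain ⟨U, V, h⟩ := kochen_specker hd f
  exact hfg' U V (hfeq V ▸ h)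

/-- There are orthonormal vectors `w`, `w'` such that a Hardy frame can force Alice to answer `w`
and Bob to answer `w'`, in any prescribed bases `U` and `V` containing these vectors. The bases
enter as fresh inputs, and the forced answers are carried over to them by one more fresh input
for each party, containing the other party's forced vector. -/
lemma exists_forced_outputs {d : ℕ} (hd : 3 ≤ d) :
    ∃ w w' : Qudit d, ‖w‖ = 1 ∧ ‖w'‖ = 1 ∧ inner ℂ w w' = 0 ∧
      ∀ (U V : ONB d) (i j : Fin d), U i = w → V j = w' → ∀ (H : Finset (Fin d × Fin d)) (p : ℝ),
      (i, j) ∉ H → 0 < p → ∑ ab ∈ H, ‖inner ℂ (U ab.1) (V ab.2)‖ ^ 2 / d = p →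
      ∃ (m n : ℕ) (α : Fin m → ONB d) (β : Fin n → ONB d) (S : Set (Fin d × Fin d × Fin m × Fin n))
        (x : Fin m) (y : Fin n),
        IsHardyParadox S H x y (quantumBox (maxEntangled d) α β) ∧
        hardyProb (quantumBox (maxEntangled d) α β) H x y = p := by
  obtain ⟨S, a, b, U₀, V₀, hS, hzero, hab, ⟨f₀, g₀, h₀⟩, hforced⟩ := exists_forced_orthogonal hd
  refine ⟨U₀ a, V₀ b, by simp, by simp, hab, fun U V i j hU hV H p hH hp hprob => ?_⟩
  -- `inr false` is the prescribed basis, `inr true` the auxiliary one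
  let α : ONB d ⊕ Bool → ONB d := Sum.elim id fun t => if t then V₀ else U
  let β : ONB d ⊕ Bool → ONB d := Sum.elim id fun t => if t then U₀ else V
  let lift : Fin d × Fin d × ONB d × ONB d →
      Fin d × Fin d × (ONB d ⊕ Bool) × (ONB d ⊕ Bool) :=
    fun s => (s.1, s.2.1, Sum.inl s.2.2.1, Sum.inl s.2.2.2)
  let S' : Set (Fin d × Fin d × (ONB d ⊕ Bool) × (ONB d ⊕ Bool)) :=
    lift '' S ∪ ((fun k => (a, k, Sum.inl U₀, Sum.inr true)) '' {k | k ≠ a} ∪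
      (fun k => (k, a, Sum.inr false, Sum.inr true)) '' {k | k ≠ i} ∪
      (fun k => (k, b, Sum.inr true, Sum.inl V₀)) '' {k | k ≠ b} ∪
      (fun k => (b, k, Sum.inr true, Sum.inr false)) '' {k | k ≠ j})
  obtain ⟨hfa, hgb⟩ := hforced f₀ g₀ h₀
  refine exists_isHardyParadox α β (S := S') (x := Sum.inr false) (y := Sum.inr false)
    ?_ ?_ ?_ ?_ hp (by simpa [α, β] using hprob)
  · refine (hS.image _).union ?_
    exact (((Set.toFinite _).union (Set.toFinite _)).union (Set.toFinite _)).union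
      (Set.toFinite _)
  · rintro a' b' x y (⟨s, hs, he⟩ | ((⟨k, hk, he⟩ | ⟨k, hk, he⟩) | ⟨k, hk, he⟩) | ⟨k, hk, he⟩) <;>
      obtain ⟨rfl, rfl, rfl, rfl⟩ := by simpa [lift] using he
    · exact hzero _ _ _ _ hs
    · simpa [α, β, orthonormal_iff_ite.1 U₀.orthonormal] using Ne.symm hk
    · simpa [α, β, ← hU, orthonormal_iff_ite.1 U.orthonormal] using hk
    · simpa [α, β, orthonormal_iff_ite.1 V₀.orthonormal] using hk
    · simpa [α, β, ← hV, orthonormal_iff_ite.1 V.orthonormal] using Ne.symm hk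
  · refine ⟨Sum.elim f₀ fun t => if t then b else i, Sum.elim g₀ fun t => if t then a else j, ?_⟩
    rintro a' b' x y (⟨s, hs, he⟩ | ((⟨k, hk, he⟩ | ⟨k, hk, he⟩) | ⟨k, hk, he⟩) | ⟨k, hk, he⟩) <;>
      obtain ⟨rfl, rfl, rfl, rfl⟩ := by simpa [lift] using he
    · exact h₀ _ _ _ _ hs
    · simpa using fun _ => Ne.symm hk
    · simpa using Ne.symm hk
    · simpa [hgb] using Ne.symm hk
    · simpa using Ne.symm hk
  · intro f g hfg
    obtain ⟨hf, hg⟩ := hforced (f ∘ Sum.inl) (g ∘ Sum.inl) fun a b U V h =>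
      hfg a b _ _ (Or.inl ⟨_, h, rfl⟩)
    simp only [Function.comp_apply] at hf hg
    have hga : g (Sum.inr true) = a := by
      by_contra hne
      exact hfg _ _ _ _ (Or.inr (Or.inl (Or.inl (Or.inl ⟨_, hne, rfl⟩)))) ⟨hf, rfl⟩
    have hfb : f (Sum.inr true) = b := by
      by_contra hne
      exact hfg _ _ _ _ (Or.inr (Or.inl (Or.inr ⟨_, hne, rfl⟩))) ⟨rfl, hg⟩
    have hfi : f (Sum.inr false) = i := by
      by_contra hne
      exact hfg _ _ _ _ (Or.inr (Or.inl (Or.inl (Or.inr ⟨_, hne, rfl⟩)))) ⟨rfl, hga⟩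
    have hgj : g (Sum.inr false) = j := by
      by_contra hne
      exact hfg _ _ _ _ (Or.inr (Or.inr ⟨_, hne, rfl⟩)) ⟨hfb, rfl⟩
    rwa [hfi, hgj]

/-! ### Bases with prescribed overlaps -/

lemma exists_basis_pair {d : ℕ} {w w' : Qudit d} (hw : ‖w‖ = 1) (hw' : ‖w'‖ = 1)
    (h : inner ℂ w w' = 0) {i j : Fin d} (hij : i ≠ j) :
    ∃ e : ONB d, e i = w ∧ e j = w' := by
  obtain ⟨e, he⟩ := exists_basis_extending (Fintype.card_fin d)
    (fun k => if k = i then w else w') {i, j} (by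
      have h' := inner_eq_zero_symm.1 h
      rintro k (rfl | rfl) l (rfl | rfl) <;>
        simp [hij, hij.symm, h, h', inner_self_eq_norm_sq_to_K, hw, hw'])
  exact ⟨e, by simpa using he i (by simp), by simpa [hij.symm] using he j (by simp)⟩

/-- Plane rotations of an orthonormal basis in the planes spanned by the pairs `e k`, `e (τ k)`,
where `τ` is an involution without fixed points and the signs `ε` orient the pairs. -/
lemma exists_rotated_basis {d : ℕ} (e : ONB d) {τ : Fin d → Fin d} {ε : Fin d → ℝ}
    (hτ : ∀ k, τ (τ k) = k) (hτk : ∀ k, τ k ≠ k) (hε : ∀ k, ε k ^ 2 = 1)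
    (hετ : ∀ k, ε (τ k) = -ε k) {c s : Fin d → ℝ} (hcs : ∀ k, c k ^ 2 + s k ^ 2 = 1)
    (hc : ∀ k, c (τ k) = c k) (hs : ∀ k, s (τ k) = s k) :
    ∃ r : ONB d, ∀ k, r k = (c k : ℂ) • e k + ((ε k * s k : ℝ) : ℂ) • e (τ k) := by
  have hee := orthonormal_iff_ite.1 e.orthonormal
  obtain ⟨r, hr⟩ := exists_basis_extending (Fintype.card_fin d)
    (fun k => (c k : ℂ) • e k + ((ε k * s k : ℝ) : ℂ) • e (τ k)) Set.univ (by
      intro k _ l _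
      simp only [inner_add_left, inner_add_right, inner_smul_left, inner_smul_right, hee,
        Complex.conj_ofReal]
      rcases eq_or_ne k l with rfl | hkl
      · have h1 : c k * c k + ε k * s k * (ε k * s k) = 1 := by
          linear_combination hcs k + s k ^ 2 * hε k
        simpa [hτk, (hτk _).symm] using mod_cast h1
      · have hττ : τ k ≠ τ l := fun h => hkl (by rw [← hτ k, h, hτ])
        rcases eq_or_ne (τ k) l with rfl | hkl'
        · have h1 : c (τ k) * (ε k * s k) + ε (τ k) * s (τ k) * c k = 0 := by
            rw [hετ, hs, hc]
            ring
          simpa [hτ, hkl, (hτk _).symm, hτk] using mod_cast h1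
        · have : k ≠ τ l := fun h => hkl' (by rw [h, hτ])
          simp [hkl, hkl', hττ, this])
  exact ⟨r, fun k => hr k trivial⟩

/-- Rotating all planes by the same angle, but those through `e j` in the first basis and the
others in the second, keeps `u i = w` and `v j = w'` and makes all diagonal overlaps equal. -/
lemma exists_bases_diagonal_overlap {d : ℕ} {w w' : Qudit d} (hw : ‖w‖ = 1) (hw' : ‖w'‖ = 1)
    (h : inner ℂ w w' = 0) {τ : Fin d → Fin d} {ε : Fin d → ℝ}
    (hτ : ∀ k, τ (τ k) = k) (hτk : ∀ k, τ k ≠ k) (hε : ∀ k, ε k ^ 2 = 1)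
    (hετ : ∀ k, ε (τ k) = -ε k) {i j : Fin d} (hij : i ≠ j) (hij' : i ≠ τ j)
    {p : ℝ} (hp : 0 ≤ p) (hp1 : p ≤ 1) :
    ∃ u v : ONB d, u i = w ∧ v j = w' ∧ ∀ k, ‖inner ℂ (u k) (v k)‖ ^ 2 = p := by
  classical
  obtain ⟨e, hei, hej⟩ := exists_basis_pair hw hw' h hij
  have hee := orthonormal_iff_ite.1 e.orthonormal
  have hcs : √p ^ 2 + √(1 - p) ^ 2 = 1 := by
    rw [Real.sq_sqrt hp, Real.sq_sqrt (by linarith)]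
    ring
  have hmem : ∀ k, (τ k = j ∨ τ k = τ j) ↔ (k = j ∨ k = τ j) := by
    intro k
    constructor
    · rintro (rfl | h)
      · exact Or.inr (hτ k).symm
      · exact Or.inl (by rw [← hτ k, h, hτ])
    · rintro (rfl | rfl)
      · exact Or.inr rfl
      · exact Or.inl (hτ j)
  obtain ⟨u, hu⟩ := exists_rotated_basis e hτ hτk hε hετ
    (c := fun k => if k = j ∨ k = τ j then √p else 1)
    (s := fun k => if k = j ∨ k = τ j then √(1 - p) else 0)
    (fun k => by split_ifs <;> simp [hcs]) (fun k => by simp only [hmem])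
    (fun k => by simp only [hmem])
  obtain ⟨v, hv⟩ := exists_rotated_basis e hτ hτk hε hετ
    (c := fun k => if k = j ∨ k = τ j then 1 else √p)
    (s := fun k => if k = j ∨ k = τ j then 0 else √(1 - p))
    (fun k => by split_ifs <;> simp [hcs]) (fun k => by simp only [hmem])
    (fun k => by simp only [hmem])
  refine ⟨u, v, by simp [hu, hij, hij', hei], by simp [hv, hej], fun k => ?_⟩
  have : inner ℂ (u k) (v k) = ((√p : ℝ) : ℂ) := by
    rw [hu, hv]
    by_cases hk : k = j ∨ k = τ j <;>
      simp [hk, hee, hτk, (hτk _).symm]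
  rw [this, Complex.norm_real, Real.norm_eq_abs, sq_abs, Real.sq_sqrt hp]

lemma exists_bases_single_overlap {d : ℕ} {w w' : Qudit d} (hw : ‖w‖ = 1) (hw' : ‖w'‖ = 1)
    (h : inner ℂ w w' = 0) {i j k : Fin d} (hij : i ≠ j) (hik : i ≠ k) (hjk : j ≠ k)
    {q : ℝ} (hq : 0 ≤ q) (hq1 : q ≤ 1) :
    ∃ u v : ONB d, u i = w ∧ v j = w' ∧ ‖inner ℂ (u k) (v i)‖ ^ 2 = q := by
  obtain ⟨e, hei, hej⟩ := exists_basis_pair hw hw' h hij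
  have hee := orthonormal_iff_ite.1 e.orthonormal
  have hcs : √q * √q + √(1 - q) * √(1 - q) = 1 := by
    rw [Real.mul_self_sqrt hq, Real.mul_self_sqrt (by linarith)]
    ring
  let t : Qudit d := ((√q : ℝ) : ℂ) • e k + ((√(1 - q) : ℝ) : ℂ) • e i
  have htt : inner ℂ t t = (1 : ℂ) := by
    simp only [t, inner_add_left, inner_add_right, inner_smul_left, inner_smul_right, hee,
      Complex.conj_ofReal, if_true, if_neg hik, if_neg hik.symm, mul_zero, mul_one, add_zero,
      zero_add]
    exact_mod_cast hcs
  have htj : inner ℂ t (e j) = (0 : ℂ) := by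
    simp [t, hee, hij, hjk.symm]
  have ht : ‖t‖ = 1 := by
    have h1 := inner_self_eq_norm_sq (𝕜 := ℂ) t
    rw [htt, RCLike.one_re, eq_comm] at h1
    exact (pow_eq_one_iff_of_nonneg (norm_nonneg t) two_ne_zero).1 h1
  obtain ⟨v, hvi, hvj⟩ := exists_basis_pair ht hw' (hej ▸ htj) hij
  refine ⟨e, v, hei, hvj, ?_⟩
  have : inner ℂ (e k) t = ((√q : ℝ) : ℂ) := by
    simp [t, hee, hik.symm]
  rw [hvi, this, Complex.norm_real, Real.norm_eq_abs, sq_abs, Real.sq_sqrt hq]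

lemma exists_isHardyParadox_diagonal {d : ℕ} (hd : 3 ≤ d) {τ : Fin d → Fin d} {ε : Fin d → ℝ}
    (hτ : ∀ k, τ (τ k) = k) (hτk : ∀ k, τ k ≠ k) (hε : ∀ k, ε k ^ 2 = 1)
    (hετ : ∀ k, ε (τ k) = -ε k) {i j : Fin d} (hij : i ≠ j) (hij' : i ≠ τ j)
    {p : ℝ} (hp : 0 < p) (hp1 : p ≤ 1) :
    ∃ (m n : ℕ) (α : Fin m → ONB d) (β : Fin n → ONB d) (S : Set (Fin d × Fin d × Fin m × Fin n))
      (x : Fin m) (y : Fin n),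
      IsHardyParadox S (diagonalOutputs d) x y (quantumBox (maxEntangled d) α β) ∧
      hardyProb (quantumBox (maxEntangled d) α β) (diagonalOutputs d) x y = p := by
  obtain ⟨w, w', hw, hw', h, hforced⟩ := exists_forced_outputs hd
  obtain ⟨u, v, hu, hv, huv⟩ :=
    exists_bases_diagonal_overlap hw hw' h hτ hτk hε hετ hij hij' hp.le hp1
  refine hforced u v i j hu hv _ p (by simp [diagonalOutputs, hij]) hp ?_
  have hd0 : (d : ℝ) ≠ 0 := by
    have : d ≠ 0 := by omega
    exact_mod_cast this
  rw [diagonalOutputs, Finset.sum_image (fun k _ l _ h => (Prod.mk.inj h).1)]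
  simp only [huv, Finset.sum_const, Finset.card_univ, Fintype.card_fin, nsmul_eq_mul]
  field_simp

end HardyParadox

theorem mainTheorem3 :
    (∀ d : ℕ, 3 ≤ d → ∀ p : ℝ, 0 < p → p ≤ 1 / (d : ℝ) →
      ∃ (m n : ℕ)
        (α : Fin m → OrthonormalBasis (Fin d) ℂ (HardyParadox.Qudit d))
        (β : Fin n → OrthonormalBasis (Fin d) ℂ (HardyParadox.Qudit d))
        (S : Set (Fin d × Fin d × Fin m × Fin n))
        (a : Fin d) (b : Fin d) (x : Fin m) (y : Fin n),
        HardyParadox.IsHardyParadox S {(a, b)} x y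
            (HardyParadox.quantumBox (HardyParadox.maxEntangled d) α β) ∧
          HardyParadox.quantumBox (HardyParadox.maxEntangled d) α β a b x y = p) ∧
    (∀ d : ℕ, d = 4 ∨ d = 8 → ∀ p : ℝ, 0 < p → p ≤ 1 →
      ∃ (m n : ℕ)
        (α : Fin m → OrthonormalBasis (Fin d) ℂ (HardyParadox.Qudit d))
        (β : Fin n → OrthonormalBasis (Fin d) ℂ (HardyParadox.Qudit d))
        (S : Set (Fin d × Fin d × Fin m × Fin n))
        (x : Fin m) (y : Fin n),
        HardyParadox.IsHardyParadox S (HardyParadox.diagonalOutputs d) x y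
            (HardyParadox.quantumBox (HardyParadox.maxEntangled d) α β) ∧
          HardyParadox.hardyProb
            (HardyParadox.quantumBox (HardyParadox.maxEntangled d) α β)
            (HardyParadox.diagonalOutputs d) x y = p) := by
  refine ⟨fun d hd p hp hpd => ?_, ?_⟩
  · -- Alice's output `0` is forced, so any Hardy pair in which she answers `2` will do
    have h0 : 0 < d := by omega
    have h1 : 1 < d := by omega
    have h2 : 2 < d := by omega
    have hd0 : (0 : ℝ) < d := by exact_mod_cast h0
    obtain ⟨w, w', hw, hw', h, hforced⟩ := HardyParadox.exists_forced_outputs hd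
    obtain ⟨u, v, hu, hv, huv⟩ := HardyParadox.exists_bases_single_overlap hw hw' h
      (i := ⟨0, h0⟩) (j := ⟨1, h1⟩) (k := ⟨2, h2⟩) (by simp) (by simp) (by simp)
      (q := p * d) (by positivity) ((le_div_iff₀ hd0).1 hpd)
    obtain ⟨m, n, α, β, S, x, y, hP, hprob⟩ := hforced u v _ _ hu hv
      {(⟨2, h2⟩, ⟨0, h0⟩)} p (by simp) hp
      (by rw [Finset.sum_singleton, huv, mul_div_cancel_right₀ _ hd0.ne'])
    refine ⟨m, n, α, β, S, _, _, x, y, hP, ?_⟩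
    rwa [HardyParadox.hardyProb, Finset.sum_singleton] at hprob
  · -- the pairs are `k`, `k + d / 2`, oriented by which of the two is smaller
    rintro d (rfl | rfl) p hp hp1
    · exact HardyParadox.exists_isHardyParadox_diagonal (by norm_num)
        (τ := fun k => k + 2) (ε := fun k => if k < 2 then 1 else -1)
        (by decide) (by decide) (fun k => by split_ifs <;> norm_num)
        (fun k => by fin_cases k <;> simp) (i := 0) (j := 1) (by decide) (by decide) hp hp1
    · exact HardyParadox.exists_isHardyParadox_diagonal (by norm_num)
        (τ := fun k => k + 4) (ε := fun k => if k < 4 then 1 else -1)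
        (by decide) (by decide) (fun k => by split_ifs <;> norm_num)
        (fun k => by fin_cases k <;> simp) (i := 0) (j := 1) (by decide) (by decide) hp hp1
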